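/- Let $n\ge 3$. Let $\mathrm{Cr}_n$ be the group of birational automorphisms of $\mathbb{P}^n$ over $\mathbb{C}$, with product $gf:=g\circ f$. Write $f=[f_0:\dots:f_n]$ with homogeneous polynomials $f_i\in\mathbb{C}[X_0,\dots,X_n]$ of one common degree, not necessarily coprime. For a nonzero homogeneous $h$ let $d_h$ be its degree in $X_0$, and let $I_h\in\mathbb{Z}_{\ge 0}^n$ be the lexicographically largest $I$ such that the monomial $X_0^{d_h}X^I$, $X^I:=X_1^{i_1}\cdots X_n^{i_n}$, occurs in $h$. Let $G\subset \mathrm{Cr}_n$ be the set of all $f$ such that both $f$ and $f^{-1}$ can be written as $[f_0:\dots:f_n]$ with $$f_0=\alpha_0X_0^{d}X^{I_{f_0}}+(\text{lower powers of }X_0),\qquad f_j=\alpha_jX_0^{d-1}X^{I_{f_j}}+(\text{lower powers of }X_0)\quad(1\le j\le n)$$ for some integer $d\ge 1$ (depending on the map) and some $\alpha_0,\dots,\alpha_n\in\mathbb{C}^*$; $G$ is a subgroup of $\mathrm{Cr}_n$. For $f=[f_0:\dots:f_n]\in G$ let $M_f$ be the integer $n\times n$ matrix whose $j$-th column is $I_{f_j}-I_{f_0}$.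 Let $GL'_n(\mathbb{Z})$ (resp. $SL'_n(\mathbb{Z})$) be the group of all $A\in GL_n(\mathbb{Z})$ (resp. $A\in SL_n(\mathbb{Z})$) that fix the column vector $(1,\dots,1)^{T}$. Then $M_f$ does not depend on the choice of the $f_i$, it lies in $GL_n(\mathbb{Z})$, and $M_{gf}=M_fM_g$ for all $f,g\in G$; in other words, $\rho(f):=M_f^{T}$ defines a group homomorphism $\rho:G\to GL_n(\mathbb{Z})$. Its image is $GL'_n(\mathbb{Z})$. It is split by the homomorphism $s:GL'_n(\mathbb{Z})\to G$ that sends $A$ to the monomial map whose $j$-th component in the affine coordinates $x_i=X_i/X_0$ is $\prod_i x_i^{A_{j,i}}$, so that, with $\Lambda_n:=\ker\rho$, $$G=\Lambda_n\rtimes s(GL'_n(\mathbb{Z})),\qquad \rho^{-1}(SL'_n(\mathbb{Z}))=\Lambda_n\rtimes s(SL'_n(\mathbb{Z})).$$ Moreover, the free group $F_2$ on two generators embeds into the group $\mathrm{Out}(\Lambda_n)$ of outer automorphisms of $\Lambda_n$. -/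

import Mathlib

open MvPolynomial

noncomputable section

/-- The field `ℂ(x_1, …, x_n)` of rational functions on affine `n`-space, that is, on the chart
`X_0 ≠ 0` of `ℙⁿ`, where `x_j = X_j / X_0`. -/
abbrev FunField (n : ℕ) : Type := FractionRing (MvPolynomial (Fin n) ℂ)

/-- The affine coordinate `x_j = X_j / X_0` (the indices `1, …, n` are `Fin n` here). -/
def coord {n : ℕ} (j : Fin n) : FunField n := algebraMap (MvPolynomial (Fin n) ℂ) _ (X j)

/-- The Cremona group of birational automorphisms of affine (or projective) `n`-space over `ℂ`.
A birational automorphism `f` is given by its pull-back `f.unop = f^*`, a `ℂ`-automorphism of the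
function field. As `(g ∘ f)^* = f^* ∘ g^*`, the opposite multiplication makes `g * f` the
composition `g ∘ f` ("first `f`, then `g`"). -/
abbrev Cremona (n : ℕ) : Type := (FunField n ≃ₐ[ℂ] FunField n)ᵐᵒᵖ

/-- `h(X_0, …, X_n) ↦ h(1, x_1, …, x_n)`, restriction to the affine chart `X_0 ≠ 0`. -/
def atChart {n : ℕ} : MvPolynomial (Fin (n + 1)) ℂ →ₐ[ℂ] FunField n :=
  aeval (Fin.cons 1 coord)

/-- `f = [F_0 : … : F_n]`: the `F_i` are homogeneous polynomials of one common degree (not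
necessarily coprime), and in affine coordinates the `j`-th component of `f` is `F_j / F_0`. -/
structure Represents {n : ℕ} (F : Fin (n + 1) → MvPolynomial (Fin (n + 1)) ℂ) (f : Cremona n) :
    Prop where
  homogeneous : ∃ e : ℕ, ∀ i, (F i).IsHomogeneous e
  ne_zero : atChart (F 0) ≠ 0
  pullback : ∀ j : Fin n, f.unop (coord j) = atChart (F j.succ) / atChart (F 0)

/-- The degree `d_h` of `h` in `X_0`. -/
def degZero {n : ℕ} (h : MvPolynomial (Fin (n + 1)) ℂ) : ℕ := (finSuccEquiv ℂ n h).natDegree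

/-- The coefficient of `X_0 ^ d_h` in `h`, a polynomial in `X_1, …, X_n`. -/
def topCoeff {n : ℕ} (h : MvPolynomial (Fin (n + 1)) ℂ) : MvPolynomial (Fin n) ℂ :=
  (finSuccEquiv ℂ n h).leadingCoeff

/-- The exponent `I_h`: the largest `I` in the lexicographic order (with `X_1 > … > X_n`) such that
`X_0 ^ d_h * X ^ I` occurs in `h`. -/
def leadExp {n : ℕ} (h : MvPolynomial (Fin (n + 1)) ℂ) : Fin n →₀ ℕ :=
  MonomialOrder.lex.degree (topCoeff h)

/-- The coefficient of the highest power of `X_0` in `h` is a single monomial `α X ^ I`, `α ≠ 0`. -/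
def HasMonomialTop {n : ℕ} (h : MvPolynomial (Fin (n + 1)) ℂ) : Prop :=
  ∃ (I : Fin n →₀ ℕ) (α : ℂ), α ≠ 0 ∧ topCoeff h = monomial I α

/-- The shape required of a tuple: `F_0 = α_0 X_0 ^ d X ^ {I_0} + (lower powers of X_0)` and
`F_j = α_j X_0 ^ (d - 1) X ^ {I_j} + (lower powers of X_0)` for `j ≥ 1`, with all `α_i ≠ 0`. -/
structure HasShape {n : ℕ} (F : Fin (n + 1) → MvPolynomial (Fin (n + 1)) ℂ) : Prop where
  top : ∀ i, HasMonomialTop (F i)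
  deg : ∀ j : Fin n, degZero (F j.succ) + 1 = degZero (F 0)

/-- The birational map `f` is given by some tuple of the required shape. -/
def IsAdmissible {n : ℕ} (f : Cremona n) : Prop := ∃ F, Represents F f ∧ HasShape F

/-- The matrix `M_f` computed from a tuple: its `j`-th column is `I_{F_j} - I_{F_0}`. -/
def expMatrix {n : ℕ} (F : Fin (n + 1) → MvPolynomial (Fin (n + 1)) ℂ) :
    Matrix (Fin n) (Fin n) ℤ :=
  Matrix.of fun i j => (leadExp (F j.succ) i : ℤ) - (leadExp (F 0) i : ℤ)

/-! ### The maps `f` such that `f` and `f⁻¹` have the required shape form a group -/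

section Group

variable {n : ℕ}

lemma aeval_const_mul {σ A : Type*} [CommRing A] [Algebra ℂ A] {p : MvPolynomial σ ℂ} {e : ℕ}
    (hp : p.IsHomogeneous e) (c : A) (y : σ → A) :
    aeval (fun i => c * y i) p = c ^ e * aeval y p := by
  rw [aeval_def, aeval_def, eval₂_eq, eval₂_eq, Finset.mul_sum]
  refine Finset.sum_congr rfl fun m hm => ?_
  have h : m.sum (fun _ k => k) = e := by
    have := hp (mem_support_iff.mp hm)
    rw [← this]
    simp [Finsupp.weight_apply]
  simp only [mul_pow, Finset.prod_mul_distrib, Finset.prod_pow_eq_pow_sum]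
  rw [← h, Finsupp.sum]
  ring

/-- Composition of birational maps is substitution of tuples. -/
lemma atChart_bind {F : Fin (n + 1) → MvPolynomial (Fin (n + 1)) ℂ} {f : Cremona n}
    (hF : Represents F f) {p : MvPolynomial (Fin (n + 1)) ℂ} {e : ℕ} (hp : p.IsHomogeneous e) :
    atChart (bind₁ F p) = atChart (F 0) ^ e * f.unop (atChart p) := by
  have h1 : atChart (bind₁ F p) = aeval (fun i => atChart (F i)) p := by
    rw [bind₁, ← AlgHom.comp_apply, comp_aeval]
  have h2 : f.unop (atChart p) = aeval (fun i => f.unop ((Fin.cons 1 coord : _ → FunField n) i)) p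
      := by
    rw [atChart, ← AlgEquiv.coe_toAlgHom, ← AlgHom.comp_apply, comp_aeval]
  rw [h1, h2, ← aeval_const_mul hp]
  congr 2
  funext i
  refine Fin.cases ?_ (fun j => ?_) i
  · simp
  · simp only [Fin.cons_succ]
    rw [hF.pullback, mul_div_cancel₀ _ hF.ne_zero]

lemma Represents.comp {F H : Fin (n + 1) → MvPolynomial (Fin (n + 1)) ℂ} {f g : Cremona n}
    (hF : Represents F f) (hH : Represents H g) :
    Represents (fun i => bind₁ F (H i)) (g * f) := by
  obtain ⟨e, he⟩ := hF.homogeneous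
  obtain ⟨d, hd⟩ := hH.homogeneous
  have h0 : atChart (F 0) ^ d ≠ 0 := pow_ne_zero _ hF.ne_zero
  refine ⟨⟨e * d, fun i => (hd i).aeval F he⟩, ?_, fun j => ?_⟩
  · rw [atChart_bind hF (hd 0)]
    exact mul_ne_zero h0 (by simpa using hH.ne_zero)
  · rw [atChart_bind hF (hd 0), atChart_bind hF (hd _), mul_div_mul_left _ _ h0, ← map_div₀,
      ← hH.pullback]
    rfl

lemma Represents.one : Represents (n := n) X 1 := by
  refine ⟨⟨1, fun i => isHomogeneous_X _ i⟩, by simp [atChart], fun j => by simp [atChart]⟩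

/-- Being a single nonzero term. -/
def IsSingleTerm (q : MvPolynomial (Fin n) ℂ) : Prop :=
  ∃ (I : Fin n →₀ ℕ) (α : ℂ), α ≠ 0 ∧ q = monomial I α

lemma IsSingleTerm.mul {p q : MvPolynomial (Fin n) ℂ} (hp : IsSingleTerm p) (hq : IsSingleTerm q) :
    IsSingleTerm (p * q) := by
  obtain ⟨I, a, ha, rfl⟩ := hp
  obtain ⟨J, b, hb, rfl⟩ := hq
  exact ⟨I + J, a * b, mul_ne_zero ha hb, by rw [monomial_mul]⟩

lemma IsSingleTerm.one : IsSingleTerm (1 : MvPolynomial (Fin n) ℂ) := ⟨0, 1, one_ne_zero, rfl⟩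

lemma IsSingleTerm.prod_pow {ι : Type*} (s : Finset ι) (q : ι → MvPolynomial (Fin n) ℂ)
    (m : ι → ℕ) (h : ∀ i, IsSingleTerm (q i)) : IsSingleTerm (∏ i ∈ s, q i ^ m i) := by
  have hpow : ∀ i k, IsSingleTerm (q i ^ k) := fun i k => by
    induction k with
    | zero => simpa using IsSingleTerm.one
    | succ k ih => rw [pow_succ]; exact ih.mul (h i)
  classical
  induction s using Finset.induction_on with
  | empty => simpa using IsSingleTerm.one
  | insert a s ha ih => rw [Finset.prod_insert ha]; exact (hpow _ _).mul ih

lemma IsSingleTerm.ne_zero {q : MvPolynomial (Fin n) ℂ} (h : IsSingleTerm q) : q ≠ 0 := by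
  obtain ⟨I, a, ha, rfl⟩ := h
  simpa using ha

/-- Substituting a tuple of the required shape into a homogeneous polynomial whose top coefficient
is a monomial. -/
lemma HasShape.bind {F : Fin (n + 1) → MvPolynomial (Fin (n + 1)) ℂ} {D : ℕ} (hF : HasShape F)
    (hD : degZero (F 0) = D + 1)
    {p : MvPolynomial (Fin (n + 1)) ℂ} {e : ℕ} (hp : p.IsHomogeneous e) (ht : HasMonomialTop p) :
    HasMonomialTop (bind₁ F p) ∧ degZero (bind₁ F p) = e * D + degZero p := by
  obtain ⟨I, a, ha, hI⟩ := ht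
  set P : Fin (n + 1) → Polynomial (MvPolynomial (Fin n) ℂ) := fun i => finSuccEquiv ℂ n (F i)
    with hP
  have hlc : ∀ i, IsSingleTerm (P i).leadingCoeff := hF.top
  have hPne : ∀ i, P i ≠ 0 := fun i h => (hlc i).ne_zero (by simp [h])
  have hd0 : (P 0).natDegree = D + 1 := hD
  have hdj : ∀ j : Fin n, (P j.succ).natDegree = D := fun j => by
    have := hF.deg j
    simp only [degZero] at this hD
    simp only [hP]
    omega
  set m₀ : Fin (n + 1) →₀ ℕ := Finsupp.cons (degZero p) I with hm₀
  let T : (Fin (n + 1) →₀ ℕ) → Polynomial (MvPolynomial (Fin n) ℂ) :=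
    fun m => Polynomial.C (C (coeff m p)) * ∏ i, P i ^ m i
  have hsum : finSuccEquiv ℂ n (bind₁ F p) = ∑ m ∈ p.support, T m := by
    have h1 : finSuccEquiv ℂ n (bind₁ F p) = aeval P p := by
      rw [bind₁, ← AlgEquiv.coe_toAlgHom, ← AlgHom.comp_apply, comp_aeval]
      rfl
    rw [h1, aeval_def, eval₂_eq']
    rfl
  have hTdeg : ∀ m ∈ p.support, (T m).natDegree ≤ e * D + m 0 := fun m hm => by
    have hme : ∑ i, m i = e := by
      have := hp (mem_support_iff.mp hm)
      rw [← this]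
      simp [Finsupp.weight_apply, Finsupp.sum_fintype]
    calc (T m).natDegree ≤ (∏ i, P i ^ m i).natDegree := Polynomial.natDegree_C_mul_le _ _
      _ = ∑ i, m i * (P i).natDegree := by
          rw [Polynomial.natDegree_prod _ _ fun i _ => pow_ne_zero _ (hPne i)]
          simp
      _ = e * D + m 0 := by
          rw [← hme, Fin.sum_univ_succ, Fin.sum_univ_succ (f := fun i => m i), hd0]
          simp only [hdj, ← Finset.sum_mul]
          ring
      _ ≤ _ := le_rfl
  have hcoeff : ∀ m : Fin (n + 1) →₀ ℕ, coeff m p ≠ 0 → m 0 ≤ degZero p := fun m hm => by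
    rw [degZero, natDegree_finSuccEquiv]
    exact monomial_le_degreeOf 0 (mem_support_iff.mpr hm)
  have htop : ∀ J : Fin n →₀ ℕ, coeff (Finsupp.cons (degZero p) J) p
      = if I = J then a else 0 := fun J => by
    rw [← finSuccEquiv_coeff_coeff]
    have : (finSuccEquiv ℂ n p).coeff (degZero p) = monomial I a := hI
    rw [this, coeff_monomial]
  have hm₀c : coeff m₀ p = a := by rw [hm₀, htop, if_pos rfl]
  have hm₀s : m₀ ∈ p.support := by rw [mem_support_iff, hm₀c]; exact ha
  have hother : ∀ m ∈ p.support, m ≠ m₀ → (T m).natDegree < e * D + degZero p := fun m hm hne => by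
    have h1 := hTdeg m hm
    have h2 := hcoeff m (mem_support_iff.mp hm)
    have h3 : m 0 ≠ degZero p := fun h => by
      apply hne
      have hc : m = Finsupp.cons (degZero p) m.tail := by rw [← h, Finsupp.cons_tail]
      have := mem_support_iff.mp hm
      rw [hc, htop] at this
      have hIJ : I = m.tail := by
        by_contra hh
        exact this (if_neg hh)
      rw [hc, ← hIJ]
    omega
  have hm₀e : ∑ i, m₀ i = e := by
    have := hp (mem_support_iff.mp hm₀s)
    rw [← this]
    simp [Finsupp.weight_apply, Finsupp.sum_fintype]
  have hTlead : IsSingleTerm (T m₀).leadingCoeff := by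
    simp only [T, Polynomial.leadingCoeff_mul, Polynomial.leadingCoeff_C,
      Polynomial.leadingCoeff_prod, Polynomial.leadingCoeff_pow]
    exact IsSingleTerm.mul ⟨0, _, by rw [hm₀c]; exact ha, rfl⟩ (IsSingleTerm.prod_pow _ _ _ hlc)
  have hTdeg₀ : (T m₀).natDegree = e * D + degZero p := by
    have hc0 : (C (coeff m₀ p) : MvPolynomial (Fin n) ℂ) ≠ 0 := by
      rw [hm₀c]; simpa using ha
    calc (T m₀).natDegree = (∏ i, P i ^ m₀ i).natDegree := Polynomial.natDegree_C_mul hc0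
      _ = ∑ i, m₀ i * (P i).natDegree := by
          rw [Polynomial.natDegree_prod _ _ fun i _ => pow_ne_zero _ (hPne i)]
          simp
      _ = e * D + m₀ 0 := by
          rw [← hm₀e, Fin.sum_univ_succ, Fin.sum_univ_succ (f := fun i => m₀ i), hd0]
          simp only [hdj, ← Finset.sum_mul]
          ring
      _ = _ := by rw [hm₀, Finsupp.cons_zero]
  have hco : (finSuccEquiv ℂ n (bind₁ F p)).coeff (e * D + degZero p) = (T m₀).leadingCoeff := by
    rw [hsum, Polynomial.finsetSum_coeff, Finset.sum_eq_single_of_mem m₀ hm₀s, ← hTdeg₀]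
    · rfl
    · intro m hm hne
      exact Polynomial.coeff_eq_zero_of_natDegree_lt (hother m hm hne)
  have hdeg : degZero (bind₁ F p) = e * D + degZero p := by
    apply le_antisymm
    · rw [degZero, hsum]
      refine Polynomial.natDegree_sum_le_of_forall_le _ _ fun m hm => ?_
      exact (hTdeg m hm).trans (Nat.add_le_add_left (hcoeff m (mem_support_iff.mp hm)) _)
    · exact Polynomial.le_natDegree_of_ne_zero (by rw [hco]; exact hTlead.ne_zero)
  refine ⟨?_, hdeg⟩
  have : topCoeff (bind₁ F p) = (T m₀).leadingCoeff := by
    rw [topCoeff, Polynomial.leadingCoeff, ← hco, ← hdeg]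
    rfl
  rw [HasMonomialTop, this]
  exact hTlead

lemma HasShape.one : HasShape (n := n) X where
  top i := by
    refine Fin.cases ?_ (fun j => ?_) i
    · exact ⟨0, 1, one_ne_zero, by rw [topCoeff, finSuccEquiv_X_zero, Polynomial.leadingCoeff_X]; rfl⟩
    · exact ⟨Finsupp.single j 1, 1, one_ne_zero,
        by rw [topCoeff, finSuccEquiv_X_succ, Polynomial.leadingCoeff_C]; rfl⟩
  deg j := by
    rw [degZero, degZero, finSuccEquiv_X_succ, finSuccEquiv_X_zero, Polynomial.natDegree_C,
      Polynomial.natDegree_X]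

lemma IsAdmissible.one : IsAdmissible (1 : Cremona n) := ⟨X, Represents.one, HasShape.one⟩

/-- The composition of two admissible maps is admissible. -/
lemma IsAdmissible.mul {f g : Cremona n} (hg : IsAdmissible g) (hf : IsAdmissible f) :
    IsAdmissible (g * f) := by
  obtain ⟨H, hH, hHs⟩ := hg
  obtain ⟨F, hF, hFs⟩ := hf
  obtain ⟨d, hd⟩ := hH.homogeneous
  rcases Nat.eq_zero_or_pos n with rfl | hn
  · exact ⟨X, ⟨Represents.one.homogeneous, Represents.one.ne_zero, fun j => j.elim0⟩, HasShape.one⟩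
  · obtain ⟨D, hD⟩ : ∃ D, degZero (F 0) = D + 1 := ⟨_, (hFs.deg ⟨0, hn⟩).symm⟩
    refine ⟨_, hF.comp hH, ?_⟩
    have key := fun i => hFs.bind hD (hd i) (hHs.top i)
    refine ⟨fun i => (key i).1, fun j => ?_⟩
    rw [(key _).2, (key _).2, ← hHs.deg j]
    ring

end Group

/-- The group `G`: all `f` in the Cremona group such that both `f` and `f⁻¹` have the required
shape. -/
def admissibleGroup (n : ℕ) : Subgroup (Cremona n) where
  carrier := {f | IsAdmissible f ∧ IsAdmissible f⁻¹}
  mul_mem' := fun {a b} ha hb => ⟨ha.1.mul hb.1, by rw [mul_inv_rev]; exact hb.2.mul ha.2⟩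
  one_mem' := ⟨IsAdmissible.one, by rw [inv_one]; exact IsAdmissible.one⟩
  inv_mem' := fun {a} ha => ⟨ha.2, by rw [inv_inv]; exact ha.1⟩

/-- `GL'_n(ℤ)`: the matrices in `GL_n(ℤ)` that fix the (column) vector `(1, …, 1)`. -/
def fixGL (n : ℕ) : Subgroup (GL (Fin n) ℤ) where
  carrier := {A | (A : Matrix (Fin n) (Fin n) ℤ).mulVec 1 = 1}
  mul_mem' := fun {A B} hA hB => by
    simp only [Set.mem_ofPred_eq] at hA hB ⊢
    rw [Units.val_mul, ← Matrix.mulVec_mulVec, hB, hA]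
  one_mem' := by simp
  inv_mem' := fun {A} hA => by
    simp only [Set.mem_ofPred_eq] at hA ⊢
    nth_rw 1 [← hA]
    rw [Matrix.mulVec_mulVec, ← Units.val_mul, inv_mul_cancel, Units.val_one, Matrix.one_mulVec]

/-- `SL'_n(ℤ)`: the matrices in `SL_n(ℤ)` that fix the (column) vector `(1, …, 1)`. -/
def fixSL (n : ℕ) : Subgroup (GL (Fin n) ℤ) := fixGL n ⊓ Matrix.GeneralLinearGroup.det.ker

/-- Inner automorphisms form a normal subgroup of the automorphism group. -/
instance innerNormal (H : Type*) [Group H] : (MulAut.conj (G := H)).range.Normal where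
  conj_mem := by
    rintro _ ⟨h, rfl⟩ a
    refine ⟨a h, ?_⟩
    ext x
    simp [MulAut.conj_apply]

/-- The group `Out(H) = Aut(H) / Inn(H)` of outer automorphisms of a group `H`. -/
abbrev OuterAut (H : Type*) [Group H] : Type _ := MulAut H ⧸ (MulAut.conj (G := H)).range

end

/-! Taking the dominant term, by degree in `X_0` and then lexicographically, is multiplicative. Two
tuples for the same map satisfy `F_j H_0 = H_j F_0`, so the differences `I_{F_j} - I_{F_0}` depend
on the map only.

For composition, let `F_0` have `X_0`-degree `D + 1` and the other `F_j` degree `D`. Substituting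
`F` turns a monomial `X^m` of degree `e` into a product of `X_0`-degree `e * D + m 0`. Hence only
the monomials of top `X_0`-degree contribute to the top term, and the required shape allows exactly
one of them (`HasShape.leadExp_bind`). Exponents therefore transform linearly. Comparing total
degrees shows that the columns of `M_f` sum to `1` (`Represents.sum_expMatrix`), which turns the
linear rule into `M_{gf} = M_f M_g`. Transposition gives a homomorphism on a group, so its values
are automatically invertible, and they fix `(1, …, 1)`. Monomial maps realize every such matrix and
give the splitting.

For `Out`, conjugation by the section gives `GL'_n(ℤ) → Out(ker ρ)`. It is injective because the
centralizer of `ker ρ` lies in `ker ρ` (`mem_ker_expHom_of_commute`): the kernel contains the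
diagonal torus, and whatever commutes with the torus scales each coordinate by a constant. Two
transvections in `GL'_n(ℤ)` generate a free group by ping-pong. -/

section LeadingExponent

/-! ### Multiplicativity of leading exponents, and dehomogenization. -/

variable {n : ℕ}

lemma topCoeff_ne_zero {h : MvPolynomial (Fin (n + 1)) ℂ} (hh : h ≠ 0) : topCoeff h ≠ 0 := by
  simpa [topCoeff] using hh

lemma topCoeff_mul (p q : MvPolynomial (Fin (n + 1)) ℂ) :
    topCoeff (p * q) = topCoeff p * topCoeff q := by
  simp [topCoeff, Polynomial.leadingCoeff_mul]

lemma leadExp_mul {p q : MvPolynomial (Fin (n + 1)) ℂ} (hp : p ≠ 0) (hq : q ≠ 0) :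
    leadExp (p * q) = leadExp p + leadExp q := by
  rw [leadExp, topCoeff_mul, MonomialOrder.degree_mul (topCoeff_ne_zero hp) (topCoeff_ne_zero hq)]
  rfl

lemma HasMonomialTop.ne_zero {h : MvPolynomial (Fin (n + 1)) ℂ} (hh : HasMonomialTop h) :
    h ≠ 0 := by
  rintro rfl
  obtain ⟨I, a, ha, h⟩ := hh
  exact IsSingleTerm.ne_zero ⟨I, a, ha, h⟩ (by simp [topCoeff])

/-- The monomial with exponents `degZero h` and `leadExp h` really occurs in `h`, so homogeneity
fixes its total degree. -/
lemma sum_leadExp_add_degZero {h : MvPolynomial (Fin (n + 1)) ℂ} {e : ℕ}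
    (hh : h.IsHomogeneous e) (h0 : h ≠ 0) : ∑ i, leadExp h i + degZero h = e := by
  have h1 : coeff (leadExp h) (topCoeff h) ≠ 0 :=
    (MonomialOrder.lex.leadingCoeff_ne_zero_iff).mpr (topCoeff_ne_zero h0)
  have h2 : coeff ((leadExp h).cons (degZero h)) h ≠ 0 := by
    rw [← finSuccEquiv_coeff_coeff]
    exact h1
  have := hh h2
  rw [Finsupp.weight_apply, Finsupp.sum_fintype _ _ (by simp), Fin.sum_univ_succ] at this
  simp at this
  omega

lemma atChart_eq (p : MvPolynomial (Fin (n + 1)) ℂ) :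
    atChart p = algebraMap (MvPolynomial (Fin n) ℂ) (FunField n)
      (aeval (Fin.cons 1 X : Fin (n + 1) → MvPolynomial (Fin n) ℂ) p) := by
  rw [← IsScalarTower.toAlgHom_apply ℂ, ← AlgHom.comp_apply, comp_aeval, atChart]
  congr 2
  funext i
  refine Fin.cases ?_ (fun j => ?_) i <;> simp [coord]

/-- A homogeneous polynomial that vanishes on the chart `X_0 = 1` is zero. -/
lemma atChart_injective_of_isHomogeneous {p : MvPolynomial (Fin (n + 1)) ℂ} {e : ℕ}
    (hp : p.IsHomogeneous e) (h : atChart p = 0) : p = 0 := by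
  rw [atChart_eq, FaithfulSMul.algebraMap_eq_zero_iff] at h
  -- This is the generic point of affine `(n + 1)`-space, where evaluation is injective. Homogeneity
  -- lets `x 0 ^ e` be pulled out, leaving the value of the dehomogenized `p` at `x_j / x_0`.
  set x : Fin (n + 1) → FunField (n + 1) := coord
  have hx : ∀ i, x i ≠ 0 := fun i => by simp [x, coord]
  have h1 : aeval x p = algebraMap _ (FunField (n + 1)) p := by
    rw [← IsScalarTower.toAlgHom_apply ℂ, aeval_unique (IsScalarTower.toAlgHom ℂ _ _)]
    rfl
  have h2 : x = fun i => x 0 * (Fin.cons 1 (fun j => x j.succ / x 0) : _ → FunField (n + 1)) i := by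
    funext i
    refine Fin.cases ?_ (fun j => ?_) i
    · simp
    · simp [mul_div_cancel₀ _ (hx 0)]
  have h3 : aeval (Fin.cons 1 (fun j => x j.succ / x 0) : _ → FunField (n + 1)) p
      = aeval (fun j => x j.succ / x 0)
        (aeval (Fin.cons 1 X : Fin (n + 1) → MvPolynomial (Fin n) ℂ) p) := by
    rw [← AlgHom.comp_apply, comp_aeval]
    congr 2
    funext i
    refine Fin.cases ?_ (fun j => ?_) i <;> simp
  rw [h2, aeval_const_mul hp, h3, h, map_zero, mul_zero] at h1
  simpa using h1.symm

end LeadingExponent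

/-! ### The exponent matrix and the homomorphism `ρ`. -/

section ExponentMatrix

variable {n : ℕ} {F H : Fin (n + 1) → MvPolynomial (Fin (n + 1)) ℂ} {f g : Cremona n}

lemma coord_ne_zero (j : Fin n) : (coord j : FunField n) ≠ 0 := by simp [coord]

lemma Represents.atChart_ne_zero (hF : Represents F f) (i : Fin (n + 1)) : atChart (F i) ≠ 0 := by
  refine Fin.cases hF.ne_zero (fun j h => ?_) i
  have := hF.pullback j
  rw [h, zero_div, EmbeddingLike.map_eq_zero_iff] at this
  exact coord_ne_zero j this

lemma Represents.comp_ne_zero (hF : Represents F f) (i : Fin (n + 1)) : F i ≠ 0 := fun h =>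
  hF.atChart_ne_zero i (by simp [h])

/-- The matrix `M_f` does not depend on the tuple. -/
lemma Represents.expMatrix_eq (hF : Represents F f) (hH : Represents H f) :
    expMatrix F = expMatrix H := by
  obtain ⟨d, hd⟩ := hF.homogeneous
  obtain ⟨e, he⟩ := hH.homogeneous
  ext i j
  -- The two ratios agree on the chart. Both cross products are homogeneous of degree `d + e`, so
  -- equality on the chart lifts to polynomials.
  have h1 : F j.succ * H 0 = H j.succ * F 0 := by
    rw [← sub_eq_zero]
    refine atChart_injective_of_isHomogeneous (e := d + e)
      (((hd _).mul (he _)).sub (add_comm e d ▸ (he _).mul (hd _))) ?_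
    rw [map_sub, map_mul, map_mul, sub_eq_zero,
      ← div_eq_div_iff hF.ne_zero hH.ne_zero, ← hF.pullback, hH.pullback]
  have h2 := congrArg (fun p => leadExp p i) h1
  simp only [leadExp_mul (hF.comp_ne_zero _) (hH.comp_ne_zero _),
    leadExp_mul (hH.comp_ne_zero _) (hF.comp_ne_zero _), Finsupp.add_apply] at h2
  simp only [expMatrix, Matrix.of_apply]
  omega

/-- The leading exponent after substitution of a tuple of the required shape. -/
lemma HasShape.leadExp_bind {D : ℕ} (hF : HasShape F) (hD : degZero (F 0) = D + 1)
    {p : MvPolynomial (Fin (n + 1)) ℂ} {e : ℕ} (hp : p.IsHomogeneous e) (ht : HasMonomialTop p) :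
    leadExp (bind₁ F p) = degZero p • leadExp (F 0) + ∑ j, leadExp p j • leadExp (F j.succ) := by
  have hne : ∀ i, F i ≠ 0 := fun i => (hF.top i).ne_zero
  -- By `HasMonomialTop` this is the only exponent in the support of `p` with maximal `X_0`-part.
  set m₀ : Fin (n + 1) →₀ ℕ := (leadExp p).cons (degZero p) with hm₀
  set a := coeff m₀ p with ha
  obtain ⟨I, b, hb, hI⟩ := ht
  have hIe : leadExp p = I := by
    rw [leadExp, hI, MonomialOrder.degree_monomial, if_neg hb]
  have htop : ∀ J : Fin n →₀ ℕ, coeff (Finsupp.cons (degZero p) J) p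
      = if I = J then b else 0 := fun J => by
    rw [← finSuccEquiv_coeff_coeff]
    have : (finSuccEquiv ℂ n p).coeff (degZero p) = monomial I b := hI
    rw [this, coeff_monomial]
  have hab : a = b := by rw [ha, hm₀, hIe, htop, if_pos rfl]
  have hm₀e : ∑ i, m₀ i = e := by
    have := hp (d := m₀) (by rw [← ha, hab]; exact hb)
    rw [← this]
    simp [Finsupp.weight_apply, Finsupp.sum_fintype]
  -- the remaining terms have smaller degree in `X_0`
  set P : MvPolynomial (Fin (n + 1)) ℂ := ∏ i, F i ^ m₀ i with hP
  have hP0 : P ≠ 0 := Finset.prod_ne_zero_iff.mpr fun i _ => pow_ne_zero _ (hne i)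
  -- Among monomials of degree `e`, the `X_0`-degree after substitution depends on `m 0` alone,
  -- since `F_0` has one more power of `X_0` than every other `F_j`.
  have hterm : ∀ m : Fin (n + 1) →₀ ℕ, ∑ i, m i = e →
      degZero (∏ i, F i ^ m i) = e * D + m 0 := fun m hm => by
    have hdj : ∀ j : Fin n, degZero (F j.succ) = D := fun j => by
      have := hF.deg j
      omega
    rw [degZero, map_prod, Polynomial.natDegree_prod _ _ fun i _ => by
      simpa using fun h => absurd h (hne i)]
    simp only [map_pow, Polynomial.natDegree_pow]
    change ∑ i, m i * degZero (F i) = _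
    rw [← hm, Fin.sum_univ_succ, Fin.sum_univ_succ (f := fun i => m i), hD]
    simp only [hdj, ← Finset.sum_mul]
    ring
  have hdP : degZero P = e * D + degZero p := by rw [hterm m₀ hm₀e, hm₀, Finsupp.cons_zero]
  have hsum : bind₁ F p = C a * P + ∑ m ∈ p.support.erase m₀, C (coeff m p) * ∏ i, F i ^ m i := by
    have h1 : bind₁ F p = ∑ m ∈ p.support, C (coeff m p) * ∏ i, F i ^ m i := by
      rw [bind₁, aeval_def, eval₂_eq']
      rfl
    rw [h1, ← Finset.add_sum_erase _ _ (a := m₀)]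
    rw [mem_support_iff, ← ha, hab]
    exact hb
  -- The remaining sum may be zero while the main term has degree zero; with `degree` the inequality
  -- stays strict in that case.
  have hlow : (finSuccEquiv ℂ n
      (∑ m ∈ p.support.erase m₀, C (coeff m p) * ∏ i, F i ^ m i)).degree
        < (finSuccEquiv ℂ n (C a * P)).degree := by
    have hR : (finSuccEquiv ℂ n (C a * P)).degree = ((e * D + degZero p : ℕ) : WithBot ℕ) := by
      rw [map_mul, Polynomial.degree_mul,
        Polynomial.degree_eq_natDegree (p := finSuccEquiv ℂ n P) (by simpa using hP0)]
      change _ + ((degZero P : ℕ) : WithBot ℕ) = _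
      have : finSuccEquiv ℂ n (C a) = Polynomial.C (C a) := by simp [finSuccEquiv_apply]
      rw [hdP, this, Polynomial.degree_C (by simpa [hab] using hb), zero_add]
    rw [hR, map_sum]
    refine (Polynomial.degree_sum_le _ _).trans_lt ?_
    rw [Finset.sup_lt_iff (WithBot.bot_lt_coe _)]
    intro m hm
    obtain ⟨hmne, hm⟩ := Finset.mem_erase.mp hm
    have hme : ∑ i, m i = e := by
      have := hp (mem_support_iff.mp hm)
      rw [← this]
      simp [Finsupp.weight_apply, Finsupp.sum_fintype]
    have h2 : m 0 ≤ degZero p := by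
      rw [degZero, natDegree_finSuccEquiv]
      exact monomial_le_degreeOf 0 hm
    have h3 : m 0 ≠ degZero p := fun h => by
      apply hmne
      have hc : m = Finsupp.cons (degZero p) m.tail := by rw [← h, Finsupp.cons_tail]
      have h4 := mem_support_iff.mp hm
      rw [hc, htop] at h4
      have hIJ : I = m.tail := by
        by_contra hh
        exact h4 (if_neg hh)
      rw [hc, ← hIJ, hm₀, hIe]
    refine Polynomial.degree_le_natDegree.trans_lt (WithBot.coe_lt_coe.mpr ?_)
    have : finSuccEquiv ℂ n (C (coeff m p)) = Polynomial.C (C (coeff m p)) := by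
      simp [finSuccEquiv_apply]
    rw [map_mul, this]
    refine (Polynomial.natDegree_C_mul_le _ _).trans_lt ?_
    change degZero _ < _
    rw [hterm m hme]
    exact Nat.add_lt_add_left (lt_of_le_of_ne h2 h3) _
  have htc : topCoeff (bind₁ F p) = topCoeff (C a * P) := by
    rw [topCoeff, hsum, map_add, Polynomial.leadingCoeff_add_of_degree_lt' hlow]
    rfl
  have hCa : (C a : MvPolynomial (Fin (n + 1)) ℂ) ≠ 0 := by simpa [hab] using hb
  have hCle : leadExp (C a : MvPolynomial (Fin (n + 1)) ℂ) = 0 := by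
    have : topCoeff (C a : MvPolynomial (Fin (n + 1)) ℂ) = C a := by
      simp [topCoeff, finSuccEquiv_apply]
    rw [leadExp, this, MonomialOrder.degree_C]
  have hprod : leadExp P = ∑ i, m₀ i • leadExp (F i) := by
    have : topCoeff P = ∏ i, topCoeff (F i) ^ m₀ i := by
      simp [topCoeff, hP, Polynomial.leadingCoeff_prod]
    rw [leadExp, this, MonomialOrder.degree_prod fun i _ => pow_ne_zero _ (topCoeff_ne_zero (hne i))]
    simp only [MonomialOrder.degree_pow]
    rfl
  calc leadExp (bind₁ F p) = leadExp (C a * P) := by rw [leadExp, htc, leadExp]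
    _ = ∑ i, m₀ i • leadExp (F i) := by rw [leadExp_mul hCa hP0, hCle, zero_add, hprod]
    _ = _ := by rw [Fin.sum_univ_succ]; simp [hm₀]

/-- The common degree is `d + |I_{F_0}|` and also `(d - 1) + |I_{F_j}|`, where `d = degZero (F 0)`.
-/
lemma Represents.sum_expMatrix (hF : Represents F f) (hs : HasShape F) (j : Fin n) :
    ∑ i, expMatrix F i j = 1 := by
  obtain ⟨e, he⟩ := hF.homogeneous
  have h0 := sum_leadExp_add_degZero (he 0) (hF.comp_ne_zero 0)
  have h1 := sum_leadExp_add_degZero (he j.succ) (hF.comp_ne_zero _)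
  have h2 := hs.deg j
  simp only [expMatrix, Matrix.of_apply, Finset.sum_sub_distrib, ← Nat.cast_sum]
  omega

/-- `M_{gf} = M_f M_g`. -/
lemma HasShape.expMatrix_comp (hFs : HasShape F) (hH : Represents H g)
    (hHs : HasShape H) :
    expMatrix (fun i => bind₁ F (H i)) = expMatrix F * expMatrix H := by
  obtain ⟨d, hd⟩ := hH.homogeneous
  ext i j
  obtain ⟨D, hD⟩ : ∃ D, degZero (F 0) = D + 1 := ⟨_, (hFs.deg j).symm⟩
  have hsum := hH.sum_expMatrix hHs j
  have hdeg := hHs.deg j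
  simp only [expMatrix, Matrix.of_apply] at hsum
  simp only [expMatrix, Matrix.mul_apply, Matrix.of_apply,
    hFs.leadExp_bind hD (hd _) (hHs.top _), ← hdeg]
  simp only [Finsupp.add_apply, Finsupp.smul_apply, Finsupp.finsetSum_apply, smul_eq_mul]
  push_cast
  -- The linear rule contributes `-I_{F_0}`, because `H_j` has one power of `X_0` fewer than `H_0`.
  -- The matrix product contributes `-I_{F_0}` times a column sum of `M_g`; these agree as that sum
  -- is `1`.
  have h1 : ∑ k, ((leadExp (F k.succ) i : ℤ) - leadExp (F 0) i) *
        ((leadExp (H j.succ) k : ℤ) - leadExp (H 0) k)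
      = (∑ k, (leadExp (H j.succ) k : ℤ) * leadExp (F k.succ) i)
        - (∑ k, (leadExp (H 0) k : ℤ) * leadExp (F k.succ) i)
        - leadExp (F 0) i * ∑ k, ((leadExp (H j.succ) k : ℤ) - leadExp (H 0) k) := by
    rw [Finset.mul_sum, ← Finset.sum_sub_distrib, ← Finset.sum_sub_distrib]
    exact Finset.sum_congr rfl fun k _ => by ring
  rw [h1, hsum]
  ring

/-- The transpose of the exponent matrix, as a homomorphism to matrices. -/
noncomputable def expMatrixHom (n : ℕ) : admissibleGroup n →* Matrix (Fin n) (Fin n) ℤ where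
  toFun f := (expMatrix f.2.1.choose).transpose
  map_one' := by
    rw [(1 : admissibleGroup n).2.1.choose_spec.1.expMatrix_eq Represents.one]
    ext i j
    have h0 : leadExp (X 0 : MvPolynomial (Fin (n + 1)) ℂ) = 0 := by
      rw [leadExp, topCoeff, finSuccEquiv_X_zero, Polynomial.leadingCoeff_X,
        MonomialOrder.degree_one]
    have h1 : leadExp (X i.succ : MvPolynomial (Fin (n + 1)) ℂ) = Finsupp.single i 1 := by
      rw [leadExp, topCoeff, finSuccEquiv_X_succ, Polynomial.leadingCoeff_C,
        MonomialOrder.degree_X]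
    simp [expMatrix, h0, h1, Matrix.one_apply, Finsupp.single_apply]
  map_mul' g f := by
    obtain ⟨hF, hFs⟩ := f.2.1.choose_spec
    obtain ⟨hH, hHs⟩ := g.2.1.choose_spec
    rw [(g * f).2.1.choose_spec.1.expMatrix_eq (hF.comp hH), hFs.expMatrix_comp hH hHs,
      Matrix.transpose_mul]

/-- The homomorphism `f ↦ M_fᵀ`. -/
noncomputable def expHom (n : ℕ) : admissibleGroup n →* GL (Fin n) ℤ := (expMatrixHom n).toHomUnits

lemma expHom_eq (f : admissibleGroup n) (hF : Represents F (f : Cremona n)) :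
    ((expHom n f : GL (Fin n) ℤ) : Matrix (Fin n) (Fin n) ℤ) = (expMatrix F).transpose :=
  congrArg Matrix.transpose (f.2.1.choose_spec.1.expMatrix_eq hF)

lemma expHom_mem_fixGL (f : admissibleGroup n) : expHom n f ∈ fixGL n := by
  obtain ⟨F, hF, hs⟩ := f.2.1
  change ((expHom n f : GL (Fin n) ℤ) : Matrix (Fin n) (Fin n) ℤ).mulVec 1 = 1
  rw [expHom_eq f hF]
  funext j
  simpa [Matrix.mulVec, dotProduct] using hF.sum_expMatrix hs j

end ExponentMatrix

/-! ### Laurent monomials and monomial birational maps. -/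

section LaurentMonomial

variable {n : ℕ}

/-- The Laurent monomial `x^v`. -/
noncomputable def laurent (v : Fin n → ℤ) : FunField n := ∏ i, coord i ^ v i

lemma laurent_ne_zero (v : Fin n → ℤ) : laurent v ≠ 0 :=
  Finset.prod_ne_zero_iff.mpr fun i _ => zpow_ne_zero _ (coord_ne_zero i)

lemma laurent_zero : laurent (0 : Fin n → ℤ) = 1 := by simp [laurent]

lemma laurent_add (v w : Fin n → ℤ) : laurent (v + w) = laurent v * laurent w := by
  simp [laurent, zpow_add₀ (coord_ne_zero _), Finset.prod_mul_distrib]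

lemma laurent_zsmul (k : ℤ) (v : Fin n → ℤ) : laurent (k • v) = laurent v ^ k := by
  simp [laurent, ← Finset.prod_zpow, ← zpow_mul, mul_comm]

lemma laurent_sum {ι : Type*} (s : Finset ι) (v : ι → Fin n → ℤ) :
    laurent (∑ j ∈ s, v j) = ∏ j ∈ s, laurent (v j) := by
  classical
  induction s using Finset.induction_on with
  | empty => simp [laurent_zero]
  | insert a s ha ih => rw [Finset.sum_insert ha, Finset.prod_insert ha, laurent_add, ih]

lemma laurent_single (j : Fin n) : laurent (Pi.single j 1) = (coord j : FunField n) := by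
  rw [laurent, Finset.prod_eq_single j] <;> simp +contextual

lemma algebraMap_monomial (m : Fin n →₀ ℕ) (c : ℂ) :
    algebraMap (MvPolynomial (Fin n) ℂ) (FunField n) (monomial m c)
      = algebraMap ℂ (FunField n) c * laurent (fun i => (m i : ℤ)) := by
  rw [monomial_eq, map_mul, Finsupp.prod_fintype _ _ (by simp), map_prod,
    IsScalarTower.algebraMap_apply ℂ (MvPolynomial (Fin n) ℂ), MvPolynomial.algebraMap_eq]
  simp [laurent, coord]

lemma aeval_laurent_monomial (A : Matrix (Fin n) (Fin n) ℤ) (m : Fin n →₀ ℕ) (c : ℂ) :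
    aeval (fun j => laurent (A j)) (monomial m c)
      = algebraMap ℂ (FunField n) c * laurent (Matrix.vecMul (fun i => (m i : ℤ)) A) := by
  have h : Matrix.vecMul (fun i => (m i : ℤ)) A = ∑ j, (m j : ℤ) • A j := by
    ext i
    simp [Matrix.vecMul, dotProduct]
  rw [aeval_monomial, h, laurent_sum, Finsupp.prod_fintype _ _ (by simp)]
  simp only [laurent_zsmul, zpow_natCast]

/-- Substitution of independent Laurent monomials is injective on polynomials. -/
lemma aeval_laurent_injective (A : GL (Fin n) ℤ) : Function.Injective
    (aeval (fun j => laurent ((A : Matrix (Fin n) (Fin n) ℤ) j)) :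
      MvPolynomial (Fin n) ℂ →ₐ[ℂ] FunField n) := by
  classical
  rw [injective_iff_map_eq_zero]
  intro p hp
  by_contra hp0
  obtain ⟨m₀, hm₀⟩ := ne_zero_iff.mp hp0
  -- The exponent of the image of `x^m`. Invertibility of `A` keeps distinct monomials distinct, so
  -- no cancellation can occur.
  set u : (Fin n →₀ ℕ) → Fin n → ℤ :=
    fun m => Matrix.vecMul (fun i => (m i : ℤ)) (A : Matrix (Fin n) (Fin n) ℤ) with hu
  have hu_inj : Function.Injective u := fun m m' h => by
    have := congrArg (fun v => Matrix.vecMul v ((A⁻¹ : GL (Fin n) ℤ) : Matrix (Fin n) (Fin n) ℤ)) h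
    simp only [hu, Matrix.vecMul_vecMul, ← Units.val_mul, mul_inv_cancel, Units.val_one,
      Matrix.vecMul_one] at this
    ext i
    exact_mod_cast congrFun this i
  -- Multiplying by `x^N` clears all denominators, which reduces the claim to comparing coefficients
  -- of an honest polynomial.
  set N : Fin n → ℤ := fun i => ∑ m ∈ p.support, |u m i| with hN
  have hN_nonneg : ∀ m ∈ p.support, ∀ i, 0 ≤ u m i + N i := fun m hm i => by
    have h1 := Finset.single_le_sum (f := fun m => |u m i|) (fun _ _ => abs_nonneg _) hm
    have h2 := neg_abs_le (u m i)
    simp only [hN]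
    linarith
  set w : (Fin n →₀ ℕ) → Fin n →₀ ℕ :=
    fun m => Finsupp.equivFunOnFinite.symm fun i => (u m i + N i).toNat with hw
  have hwu : ∀ m ∈ p.support, (fun i => (w m i : ℤ)) = u m + N := fun m hm => by
    funext i
    simp [hw, hN_nonneg m hm i]
  have hq : algebraMap (MvPolynomial (Fin n) ℂ) (FunField n)
      (∑ m ∈ p.support, monomial (w m) (coeff m p)) = 0 := by
    rw [p.as_sum, map_sum] at hp
    rw [map_sum, ← zero_mul (laurent N), ← hp, Finset.sum_mul]
    refine Finset.sum_congr rfl fun m hm => ?_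
    rw [algebraMap_monomial, aeval_laurent_monomial, hwu m hm, laurent_add, mul_assoc]
  rw [FaithfulSMul.algebraMap_eq_zero_iff] at hq
  have := congrArg (coeff (w m₀)) hq
  rw [coeff_sum, Finset.sum_eq_single_of_mem m₀ (mem_support_iff.mpr hm₀)] at this
  · simp only [coeff_monomial, if_true, coeff_zero] at this
    exact hm₀ this
  · intro m hm hne
    rw [coeff_monomial, if_neg]
    intro h
    apply hne
    apply hu_inj
    have := hwu m hm
    rw [h, hwu m₀ (mem_support_iff.mpr hm₀)] at this
    exact (add_right_cancel this).symm

/-- The endomorphism `x_j ↦ x^{A_j}` of the function field. -/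
noncomputable def monomialAlgHom (A : GL (Fin n) ℤ) : FunField n →ₐ[ℂ] FunField n :=
  IsFractionRing.liftAlgHom (aeval_laurent_injective A)

lemma monomialAlgHom_coord (A : GL (Fin n) ℤ) (j : Fin n) :
    monomialAlgHom A (coord j) = laurent ((A : Matrix (Fin n) (Fin n) ℤ) j) := by
  rw [monomialAlgHom, coord, IsFractionRing.liftAlgHom_apply, IsFractionRing.lift_algebraMap]
  simp

lemma funField_algHom_ext {f g : FunField n →ₐ[ℂ] FunField n}
    (h : ∀ j, f (coord j) = g (coord j)) : f = g := by
  refine IsLocalization.algHom_ext (A := MvPolynomial (Fin n) ℂ)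
    (nonZeroDivisors (MvPolynomial (Fin n) ℂ)) ?_
  refine MvPolynomial.algHom_ext fun j => ?_
  exact h j

lemma monomialAlgHom_laurent (A : GL (Fin n) ℤ) (v : Fin n → ℤ) :
    monomialAlgHom A (laurent v) = laurent (Matrix.vecMul v (A : Matrix (Fin n) (Fin n) ℤ)) := by
  have h : Matrix.vecMul v (A : Matrix (Fin n) (Fin n) ℤ)
      = ∑ j, v j • (A : Matrix (Fin n) (Fin n) ℤ) j := by
    ext i
    simp [Matrix.vecMul, dotProduct]
  rw [h, laurent_sum, laurent, map_prod]
  simp only [map_zpow₀, monomialAlgHom_coord, laurent_zsmul]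

/-- Rows are substituted as `x_j ↦ x^{A_j} ↦ x^{A_j B}`. The reversed order is that of pull-backs,
and the opposite multiplication on `Cremona` absorbs it. -/
lemma monomialAlgHom_comp (A B : GL (Fin n) ℤ) :
    (monomialAlgHom B).comp (monomialAlgHom A) = monomialAlgHom (A * B) := by
  refine funField_algHom_ext fun j => ?_
  rw [AlgHom.comp_apply, monomialAlgHom_coord, monomialAlgHom_laurent, monomialAlgHom_coord]
  congr 1

lemma monomialAlgHom_one : monomialAlgHom (1 : GL (Fin n) ℤ) = AlgHom.id ℂ _ := by
  refine funField_algHom_ext fun j => ?_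
  rw [monomialAlgHom_coord, AlgHom.id_apply, ← laurent_single]
  congr 1
  funext i
  simp [Matrix.one_apply, Pi.single_apply, eq_comm]

/-- The monomial birational maps. -/
noncomputable def monomialHom (n : ℕ) : GL (Fin n) ℤ →* Cremona n where
  toFun A := .op (AlgEquiv.ofAlgHom (monomialAlgHom A) (monomialAlgHom A⁻¹)
    (by rw [monomialAlgHom_comp, inv_mul_cancel, monomialAlgHom_one])
    (by rw [monomialAlgHom_comp, mul_inv_cancel, monomialAlgHom_one]))
  map_one' := by
    apply MulOpposite.unop_injective
    ext x
    exact DFunLike.congr_fun monomialAlgHom_one x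
  map_mul' A B := by
    apply MulOpposite.unop_injective
    ext x
    exact (DFunLike.congr_fun (monomialAlgHom_comp A B) x).symm

lemma monomialHom_coord (A : GL (Fin n) ℤ) (j : Fin n) :
    (monomialHom n A).unop (coord j) = laurent ((A : Matrix (Fin n) (Fin n) ℤ) j) :=
  monomialAlgHom_coord A j

end LaurentMonomial

/-! ### Homogeneous tuples for monomial maps. -/

section Monomial

variable {n : ℕ}

lemma finSuccEquiv_rename (q : MvPolynomial (Fin n) ℂ) :
    finSuccEquiv ℂ n (rename Fin.succ q) = Polynomial.C q := by
  have : ((finSuccEquiv ℂ n : _ →ₐ[ℂ] _).comp (rename Fin.succ)) =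
      IsScalarTower.toAlgHom ℂ (MvPolynomial (Fin n) ℂ) (Polynomial (MvPolynomial (Fin n) ℂ)) := by
    refine MvPolynomial.algHom_ext fun j => ?_
    simp [finSuccEquiv_X_succ]
  exact DFunLike.congr_fun this q

lemma atChart_rename (q : MvPolynomial (Fin n) ℂ) :
    atChart (rename Fin.succ q) = algebraMap _ (FunField n) q := by
  rw [atChart_eq, aeval_rename]
  congr 1
  exact aeval_X_left_apply q

/-- A map `x_j ↦ c_j x^{A_j}`, where the rows of `A` have sum `1`, has the required shape and the
exponent matrix `Aᵀ`. -/
lemma exists_represents_of_monomial {f : Cremona n} {A : Matrix (Fin n) (Fin n) ℤ} {c : Fin n → ℂ}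
    (hc : ∀ j, c j ≠ 0) (hA : A.mulVec 1 = 1)
    (hf : ∀ j, f.unop (coord j) = algebraMap ℂ _ (c j) * laurent (A j)) :
    ∃ F, Represents F f ∧ HasShape F ∧ expMatrix F = A.transpose := by
  -- A common denominator `X^K`: summing absolute values over all rows dominates every negative
  -- entry of `A`.
  set K : Fin n →₀ ℕ := Finsupp.equivFunOnFinite.symm fun i => ∑ j, (A j i).natAbs with hK
  set L : Fin n → Fin n →₀ ℕ :=
    fun j => Finsupp.equivFunOnFinite.symm fun i => (A j i + K i).toNat with hL
  have hLK : ∀ j i, (L j i : ℤ) = A j i + K i := fun j i => by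
    have h1 := Finset.single_le_sum (f := fun j => (A j i).natAbs) (fun _ _ => Nat.zero_le _)
      (Finset.mem_univ j)
    have h2 : 0 ≤ A j i + K i := by
      simp only [hK, Finsupp.equivFunOnFinite_symm_apply_apply]
      omega
    simp [hL, h2]
  have hLsum : ∀ j, ∑ i, L j i = 1 + ∑ i, K i := fun j => by
    have h1 : ∑ i, A j i = 1 := by simpa [Matrix.mulVec, dotProduct] using congrFun hA j
    zify
    simp only [hLK, Finset.sum_add_distrib, h1]
  -- As each row sums to `1`, the `j`-th component homogenizes to `c_j X^{A_j} / X_0`. Clearing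
  -- denominators by `X_0 X^K` gives the required shape with `d = 1`.
  set F : Fin (n + 1) → MvPolynomial (Fin (n + 1)) ℂ :=
    Fin.cons (X 0 * rename Fin.succ (monomial K 1)) fun j => rename Fin.succ (monomial (L j) (c j))
    with hF
  have hF0 : finSuccEquiv ℂ n (F 0) = Polynomial.X * Polynomial.C (monomial K 1) := by
    simp only [hF, Fin.cons_zero, map_mul, finSuccEquiv_X_zero, finSuccEquiv_rename]
  have hFj : ∀ j : Fin n, finSuccEquiv ℂ n (F j.succ) = Polynomial.C (monomial (L j) (c j)) :=
    fun j => by simp only [hF, Fin.cons_succ, finSuccEquiv_rename]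
  have hK0 : (monomial K 1 : MvPolynomial (Fin n) ℂ) ≠ 0 := by simp
  have ht0 : topCoeff (F 0) = monomial K 1 := by
    rw [topCoeff, hF0, Polynomial.leadingCoeff_mul, Polynomial.leadingCoeff_X,
      Polynomial.leadingCoeff_C, one_mul]
  have htj : ∀ j : Fin n, topCoeff (F j.succ) = monomial (L j) (c j) := fun j => by
    rw [topCoeff, hFj, Polynomial.leadingCoeff_C]
  have hc0 : atChart (F 0) = laurent fun i => (K i : ℤ) := by
    simp only [hF, Fin.cons_zero, map_mul, atChart_rename, algebraMap_monomial, map_one, one_mul]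
    simp [atChart]
  have hcj : ∀ j : Fin n, atChart (F j.succ) = algebraMap ℂ _ (c j) * laurent fun i => (L j i : ℤ) :=
    fun j => by simp only [hF, Fin.cons_succ, atChart_rename, algebraMap_monomial]
  refine ⟨F, ⟨⟨1 + ∑ i, K i, fun i => ?_⟩, ?_, fun j => ?_⟩, ⟨fun i => ?_, fun j => ?_⟩, ?_⟩
  · refine Fin.cases ?_ (fun j => ?_) i
    · refine (isHomogeneous_X _ _).mul (IsHomogeneous.rename_isHomogeneous ?_)
      exact isHomogeneous_monomial _ (by simp [Finsupp.degree_eq_sum])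
    · refine IsHomogeneous.rename_isHomogeneous (isHomogeneous_monomial _ ?_)
      rw [Finsupp.degree_eq_sum, hLsum]
  · rw [hc0]
    exact laurent_ne_zero _
  · rw [hf, hc0, hcj, eq_div_iff (laurent_ne_zero _), mul_assoc, ← laurent_add]
    congr 2
    funext i
    exact (hLK j i).symm
  · refine Fin.cases ⟨K, 1, one_ne_zero, ht0⟩ (fun j => ⟨L j, c j, hc j, htj j⟩) i
  · rw [degZero, degZero, hFj, hF0, Polynomial.natDegree_C, Polynomial.natDegree_X_mul (by simp),
      Polynomial.natDegree_C]
  · ext i j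
    simp only [expMatrix, Matrix.of_apply, leadExp, ht0, htj, MonomialOrder.degree_monomial,
      if_neg (hc j), one_ne_zero, if_false, hLK, Matrix.transpose_apply]
    ring

end Monomial

/-! ### A free group of rank two inside `GL'_n(ℤ)`. -/

section PingPong

variable {n : ℕ}

/-- The transvection `1 + 2 e_p (e_q - e_r)ᵀ`, which fixes `(1, …, 1)`. -/
def doubleShear (p q r : Fin n) (hpq : p ≠ q) (hpr : p ≠ r) : GL (Fin n) ℤ where
  val := 1 + Matrix.vecMulVec (Pi.single p 2) (Pi.single q 1 - Pi.single r 1)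
  inv := 1 - Matrix.vecMulVec (Pi.single p 2) (Pi.single q 1 - Pi.single r 1)
  -- The rank-one part squares to zero because `e_q - e_r` vanishes at `p`, so `(1 + N)(1 - N) = 1`.
  val_inv := by
    have : Matrix.vecMulVec (Pi.single p 2) (Pi.single q 1 - Pi.single r 1) *
        Matrix.vecMulVec (Pi.single p (2 : ℤ)) (Pi.single q 1 - Pi.single r 1) = 0 := by
      rw [Matrix.vecMulVec_mul_vecMulVec]
      simp [hpq, hpr]
    rw [add_mul, mul_sub, mul_sub, this]
    simp
  inv_val := by
    have : Matrix.vecMulVec (Pi.single p 2) (Pi.single q 1 - Pi.single r 1) *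
        Matrix.vecMulVec (Pi.single p (2 : ℤ)) (Pi.single q 1 - Pi.single r 1) = 0 := by
      rw [Matrix.vecMulVec_mul_vecMulVec]
      simp [hpq, hpr]
    rw [sub_mul, mul_add, mul_add, this]
    simp

lemma doubleShear_mulVec {p q r : Fin n} (hpq : p ≠ q) (hpr : p ≠ r) (v : Fin n → ℤ) :
    (doubleShear p q r hpq hpr : Matrix (Fin n) (Fin n) ℤ).mulVec v
      = v + Pi.single p (2 * (v q - v r)) := by
  ext i
  by_cases h : i = p <;>
  simp [doubleShear, Matrix.add_mulVec, Matrix.vecMulVec_mulVec, sub_dotProduct, h]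

lemma doubleShear_mem_fixGL {p q r : Fin n} (hpq : p ≠ q) (hpr : p ≠ r) :
    doubleShear p q r hpq hpr ∈ fixGL n := by
  change (doubleShear p q r hpq hpr : Matrix (Fin n) (Fin n) ℤ).mulVec 1 = 1
  simp [doubleShear_mulVec]

/-- Only the coordinate `p` changes, so the increment `2 (v q - v r)` is the same at every
iteration. -/
lemma doubleShear_zpow_mulVec {p q r : Fin n} (hpq : p ≠ q) (hpr : p ≠ r) (k : ℤ)
    (v : Fin n → ℤ) :
    ((doubleShear p q r hpq hpr ^ k : GL (Fin n) ℤ) : Matrix (Fin n) (Fin n) ℤ).mulVec v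
      = v + Pi.single p (2 * k * (v q - v r)) := by
  have hnat : ∀ (k : ℕ) (v : Fin n → ℤ),
      ((doubleShear p q r hpq hpr ^ k : GL (Fin n) ℤ) : Matrix (Fin n) (Fin n) ℤ).mulVec v
        = v + Pi.single p (2 * k * (v q - v r)) := fun k => by
    induction k with
    | zero => simp
    | succ k ih =>
      intro v
      rw [pow_succ, Units.val_mul, ← Matrix.mulVec_mulVec, doubleShear_mulVec, ih, add_assoc,
        ← Pi.single_add]
      congr 2
      simp [hpq.symm, hpr.symm]
      ring
  obtain ⟨k, rfl | rfl⟩ := k.eq_nat_or_neg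
  · exact_mod_cast hnat k v
  · rw [zpow_neg, zpow_natCast]
    have h := hnat k (v + Pi.single p (2 * -(k : ℤ) * (v q - v r)))
    have h' : v + Pi.single p (2 * -(k : ℤ) * (v q - v r)) + Pi.single p (2 * k * (v q - v r)) = v
        := by
      rw [add_assoc, ← Pi.single_add, show 2 * -(k : ℤ) * (v q - v r) + 2 * k * (v q - v r) = 0 by
        ring, Pi.single_zero, add_zero]
    simp only [Pi.add_apply, Pi.single_apply, hpq.symm, hpr.symm, if_false, add_zero, h'] at h
    nth_rw 1 [← h]
    rw [Matrix.mulVec_mulVec, ← Units.val_mul, inv_mul_cancel, Units.val_one, Matrix.one_mulVec]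

/-- The group `GL'_n(ℤ)` contains a free group of rank two if `n ≥ 3`. -/
lemma exists_freeGroup_injective_fixGL (hn : 3 ≤ n) :
    ∃ φ : FreeGroup (Fin 2) →* fixGL n, Function.Injective φ := by
  let r : Fin n := ⟨2, by omega⟩
  let p : Fin 2 → Fin n := Fin.castLE (by omega)
  have hpp : ∀ i, p i ≠ p (1 - i) := by intro i; fin_cases i <;> simp [p]
  have hpr : ∀ i, p i ≠ r := by intro i; fin_cases i <;> simp [p, r, Fin.ext_iff]
  -- On the differences `v (p 0) - v r` and `v (p 1) - v r` these act as Sanov's matrices `(1 2; 0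
  -- 1)` and `(1 0; 2 1)`.
  let a : Fin 2 → GL (Fin n) ℤ := fun i => doubleShear (p i) (p (1 - i)) r (hpp i) (hpr i)
  let act : MulAction (GL (Fin n) ℤ) (Fin n → ℤ) :=
    { smul := fun g v => (g : Matrix (Fin n) (Fin n) ℤ).mulVec v
      one_smul := fun v => Matrix.one_mulVec v
      mul_smul := fun g h v => (Matrix.mulVec_mulVec v g.1 h.1).symm }
  have hinj : Function.Injective (FreeGroup.lift a) := by
    have hlift : FreeGroup.lift a =
        (Monoid.CoprodI.lift fun i => FreeGroup.lift fun _ : Unit => a i).comp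
          (@freeGroupEquivCoprodI (Fin 2)).toMonoidHom := by
      ext i
      simp
    rw [hlift, MonoidHom.coe_comp]
    refine Function.Injective.comp ?_ (MulEquiv.injective freeGroupEquivCoprodI)
    refine Monoid.CoprodI.lift_injective_of_ping_pong (α := Fin n → ℤ) _ ?_
      (fun i => {v | |v (p (1 - i)) - v r| < |v (p i) - v r|}) (fun i => ?_) ?_ ?_
    -- Ping-pong with only two factors needs one factor with at least three elements; here each is
    -- infinite cyclic.
    · right
      refine ⟨0, ?_⟩
      rw [Cardinal.mk_eq_aleph0]
      exact (Cardinal.natCast_lt_aleph0 (n := 3)).le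
    · refine ⟨Pi.single (p i) 1, ?_⟩
      simp [hpp i, hpr i]
    · intro i j hij
      obtain rfl : j = 1 - i := by omega
      rw [Function.onFun, Set.disjoint_left]
      intro v hv hv'
      simp only [sub_sub_cancel, Set.mem_ofPred_eq] at hv hv'
      exact lt_asymm hv hv'
    · intro i j hij h hh
      obtain rfl : j = 1 - i := by omega
      obtain ⟨k, rfl⟩ := FreeGroup.freeGroupUnitEquivInt.symm.surjective h
      have hk : k ≠ 0 := by
        rintro rfl
        exact hh (by simp [FreeGroup.freeGroupUnitEquivInt])
      rintro _ ⟨v, hv, rfl⟩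
      simp only [sub_sub_cancel, Set.mem_ofPred_eq] at hv
      have hgv : (FreeGroup.lift (fun _ : Unit => a i)
          (FreeGroup.freeGroupUnitEquivInt.symm k)) • v
            = v + Pi.single (p i) (2 * k * (v (p (1 - i)) - v r)) := by
        rw [← doubleShear_zpow_mulVec (hpp i) (hpr i)]
        change (FreeGroup.lift (fun _ : Unit => a i) (FreeGroup.of () ^ k)).1.mulVec v = _
        rw [map_zpow, FreeGroup.lift_apply_of]
      change (FreeGroup.lift (fun _ : Unit => a i)
        (FreeGroup.freeGroupUnitEquivInt.symm k)) • v ∈ _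
      rw [hgv, Set.mem_ofPred_eq]
      simp only [Pi.add_apply, Pi.single_eq_same, Pi.single_eq_of_ne (hpp i).symm,
        Pi.single_eq_of_ne (hpr i).symm, add_zero]
      -- From `|x| < |y|` follows `|x + 2 k y| ≥ 2 |k| |y| - |x| > |y|` for `k ≠ 0`. This is where
      -- the factor `2` in the shears is used.
      set y := v (p (1 - i)) - v r
      set x := v (p i) - v r with hx
      have h1 : 1 ≤ |k| := Int.one_le_abs hk
      have h2 : |2 * k * y| = 2 * (|k| * |y|) := by rw [abs_mul, abs_mul, abs_two, mul_assoc]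
      have h3 : |2 * k * y| - |x| ≤ |x + 2 * k * y| := by
        have := abs_sub_abs_le_abs_sub (2 * k * y) (-x : ℤ)
        rwa [abs_neg, sub_neg_eq_add, add_comm _ x] at this
      have h4 : |y| ≤ |k| * |y| := le_mul_of_one_le_left (abs_nonneg _) h1
      have h5 : v (p i) + 2 * k * y - v r = x + 2 * k * y := by rw [hx]; ring
      rw [h5]
      linarith
  refine ⟨FreeGroup.lift fun i => ⟨a i, doubleShear_mem_fixGL _ _⟩, fun x y hxy => hinj ?_⟩
  have hcomp : (fixGL n).subtype.comp
      (FreeGroup.lift fun i => (⟨a i, doubleShear_mem_fixGL _ _⟩ : fixGL n)) = FreeGroup.lift a := by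
    ext i
    simp
  rw [← hcomp, MonoidHom.comp_apply, MonoidHom.comp_apply, hxy]

end PingPong

/-! ### The diagonal torus and its centralizer. -/

section Torus

variable {n : ℕ}

/-- The substitution `X_j ↦ c_j X_j`. -/
noncomputable def scaleEquiv (c : Fin n → ℂˣ) : MvPolynomial (Fin n) ℂ ≃ₐ[ℂ] MvPolynomial (Fin n) ℂ :=
  AlgEquiv.ofAlgHom (aeval fun j => C (c j : ℂ) * X j) (aeval fun j => C ((c j)⁻¹ : ℂˣ).1 * X j)
    (MvPolynomial.algHom_ext fun j => by
      simp only [AlgHom.comp_apply, aeval_X, map_mul, algHom_C, MvPolynomial.algebraMap_eq]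
      rw [← mul_assoc, ← C_mul]
      simp)
    (MvPolynomial.algHom_ext fun j => by
      simp only [AlgHom.comp_apply, aeval_X, map_mul, algHom_C, MvPolynomial.algebraMap_eq]
      rw [← mul_assoc, ← C_mul]
      simp)

lemma scaleEquiv_X (c : Fin n → ℂˣ) (j : Fin n) : scaleEquiv c (X j) = C (c j : ℂ) * X j :=
  aeval_X (fun j => C (c j : ℂ) * X j) j

lemma scaleEquiv_symm_X (c : Fin n → ℂˣ) (j : Fin n) :
    (scaleEquiv c).symm (X j) = C ((c j)⁻¹ : ℂˣ).1 * X j :=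
  aeval_X (fun j => C ((c j)⁻¹ : ℂˣ).1 * X j) j

lemma eval_scaleEquiv (c : Fin n → ℂˣ) (y : Fin n → ℂ) (p : MvPolynomial (Fin n) ℂ) :
    eval y (scaleEquiv c p) = eval (fun j => c j * y j) p := by
  change eval y (aeval (fun j => C (c j : ℂ) * X j) p) = _
  rw [← coe_aeval_eq_eval, ← coe_aeval_eq_eval, RingHom.coe_coe, RingHom.coe_coe,
    ← AlgHom.comp_apply, comp_aeval]
  simp

/-- The diagonal map `x_j ↦ c_j x_j`. -/
noncomputable def diagonalMap (c : Fin n → ℂˣ) : Cremona n :=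
  .op (IsFractionRing.algEquivOfAlgEquiv (scaleEquiv c))

lemma diagonalMap_algebraMap (c : Fin n → ℂˣ) (p : MvPolynomial (Fin n) ℂ) :
    (diagonalMap c).unop (algebraMap _ (FunField n) p) = algebraMap _ _ (scaleEquiv c p) :=
  IsFractionRing.algEquivOfAlgEquiv_algebraMap _ _

lemma algebraMap_C_mul_X (z : ℂ) (j : Fin n) :
    algebraMap (MvPolynomial (Fin n) ℂ) (FunField n) (C z * X j)
      = algebraMap ℂ _ z * laurent ((1 : Matrix (Fin n) (Fin n) ℤ) j) := by
  have : (1 : Matrix (Fin n) (Fin n) ℤ) j = Pi.single j 1 := by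
    funext i
    simp [Matrix.one_apply, Pi.single_apply, eq_comm]
  rw [this, laurent_single, map_mul, IsScalarTower.algebraMap_apply ℂ (MvPolynomial (Fin n) ℂ)]
  rfl

lemma diagonalMap_coord (c : Fin n → ℂˣ) (j : Fin n) :
    (diagonalMap c).unop (coord j)
      = algebraMap ℂ _ (c j : ℂ) * laurent ((1 : Matrix (Fin n) (Fin n) ℤ) j) := by
  rw [coord, diagonalMap_algebraMap, ← algebraMap_C_mul_X, scaleEquiv_X]

lemma diagonalMap_inv_coord (c : Fin n → ℂˣ) (j : Fin n) :
    ((diagonalMap c)⁻¹).unop (coord j)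
      = algebraMap ℂ _ ((c j)⁻¹ : ℂˣ).1 * laurent ((1 : Matrix (Fin n) (Fin n) ℤ) j) := by
  change (IsFractionRing.algEquivOfAlgEquiv (scaleEquiv c)).symm (coord j) = _
  rw [IsFractionRing.algEquivOfAlgEquiv_symm, coord, IsFractionRing.algEquivOfAlgEquiv_algebraMap,
    ← algebraMap_C_mul_X, scaleEquiv_symm_X]

lemma diagonalMap_mem (c : Fin n → ℂˣ) : diagonalMap c ∈ admissibleGroup n := by
  obtain ⟨F, hF, hs, -⟩ := exists_represents_of_monomial (fun j => (c j).ne_zero)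
    (by simp) (diagonalMap_coord c)
  obtain ⟨H, hH, hHs, -⟩ := exists_represents_of_monomial (fun j => ((c j)⁻¹).ne_zero)
    (by simp) (diagonalMap_inv_coord c)
  exact ⟨⟨F, hF, hs⟩, ⟨H, hH, hHs⟩⟩

/-- A map in `G` that multiplies every coordinate by a constant lies in the kernel. -/
lemma mem_ker_expHom {f : admissibleGroup n} {c : Fin n → ℂ} (hc : ∀ j, c j ≠ 0)
    (hf : ∀ j, (f : Cremona n).unop (coord j) = algebraMap ℂ _ (c j) * coord j) :
    f ∈ (expHom n).ker := by
  have hf' : ∀ j, (f : Cremona n).unop (coord j)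
      = algebraMap ℂ _ (c j) * laurent ((1 : Matrix (Fin n) (Fin n) ℤ) j) := fun j => by
    rw [hf, ← laurent_single]
    congr 2
    funext i
    simp [Matrix.one_apply, Pi.single_apply, eq_comm]
  obtain ⟨F, hF, -, hM⟩ := exists_represents_of_monomial hc (by simp) hf'
  rw [MonoidHom.mem_ker]
  apply Units.ext
  rw [expHom_eq f hF, hM]
  simp

/-- Polynomials that agree on the torus are equal. -/
lemma eq_of_eval_units {p q : MvPolynomial (Fin n) ℂ}
    (h : ∀ y : Fin n → ℂˣ, eval (fun j => (y j : ℂ)) p = eval (fun j => (y j : ℂ)) q) : p = q := by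
  refine funext_set (fun _ => {0}ᶜ) (fun _ => (Set.finite_singleton 0).infinite_compl)
    fun x hx => ?_
  exact h fun j => Units.mk0 (x j) (hx j trivial)

/-- The only rational functions that are invariant under the torus are the constants. -/
lemma exists_eq_algebraMap_of_invariant {q : FunField n}
    (h : ∀ c : Fin n → ℂˣ, (diagonalMap c).unop q = q) : ∃ z : ℂ, q = algebraMap ℂ _ z := by
  obtain ⟨a, b, hb, rfl⟩ := IsFractionRing.div_surjective (A := MvPolynomial (Fin n) ℂ) q
  have hb0 : b ≠ 0 := nonZeroDivisors.ne_zero hb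
  have hbK : ∀ {p : MvPolynomial (Fin n) ℂ}, p ≠ 0 → algebraMap _ (FunField n) p ≠ 0 :=
    fun hp => by simpa using hp
  obtain ⟨y, hy⟩ : ∃ y : Fin n → ℂˣ, eval (fun j => (y j : ℂ)) b ≠ 0 := by
    by_contra! hh
    exact hb0 (eq_of_eval_units (by simpa using hh))
  set s := eval (fun j => (y j : ℂ)) a
  set t := eval (fun j => (y j : ℂ)) b
  have hab : C t * a = C s * b := by
    refine eq_of_eval_units fun z => ?_
    -- The torus element `z / y` moves `y` to `z`. Invariance of `a / b`, evaluated at `y`, then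
    -- gives `a(z) b(y) = a(y) b(z)`, so `q` is the constant `a(y) / b(y)`.
    have h1 := h fun j => z j / y j
    rw [map_div₀, diagonalMap_algebraMap, diagonalMap_algebraMap,
      div_eq_div_iff (hbK (by simpa using hb0)) (hbK hb0), ← map_mul, ← map_mul] at h1
    have h2 := congrArg (eval fun j => (y j : ℂ)) (IsFractionRing.injective _ (FunField n) h1)
    simp only [map_mul, eval_scaleEquiv, Units.val_div_eq_div_val, eval_C] at h2 ⊢
    simp only [div_mul_cancel₀ _ (Units.ne_zero _)] at h2
    linear_combination h2
  refine ⟨s / t, ?_⟩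
  rw [div_eq_iff (hbK hb0), map_div₀, div_mul_eq_mul_div, eq_div_iff (by simpa using hy)]
  have := congrArg (algebraMap _ (FunField n)) hab
  rw [map_mul, map_mul, ← MvPolynomial.algebraMap_eq, ← IsScalarTower.algebraMap_apply,
    ← IsScalarTower.algebraMap_apply] at this
  rw [← this, mul_comm]

/-- The centralizer of the torus consists of maps that multiply the coordinates by constants. -/
lemma exists_smul_coord_of_commute {f : Cremona n} (h : ∀ c : Fin n → ℂˣ, Commute f (diagonalMap c))
    (j : Fin n) : ∃ z : ℂ, z ≠ 0 ∧ f.unop (coord j) = algebraMap ℂ _ z * coord j := by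
  have hδ : ∀ c : Fin n → ℂˣ, (diagonalMap c).unop (coord j)
      = algebraMap ℂ (FunField n) (c j : ℂ) * coord j := fun c => by
    rw [diagonalMap_coord, ← laurent_single j]
    congr 2
    funext i
    simp [Matrix.one_apply, Pi.single_apply, eq_comm]
  -- A torus element scales both `f^* x_j` (by commutation) and `x_j` by the same `c j`, so the
  -- quotient is invariant.
  obtain ⟨z, hz⟩ := exists_eq_algebraMap_of_invariant (q := f.unop (coord j) / coord j) fun c => by
    have h1 : (diagonalMap c).unop (f.unop (coord j)) = f.unop ((diagonalMap c).unop (coord j)) :=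
      DFunLike.congr_fun (congrArg MulOpposite.unop (h c).eq) (coord j)
    rw [map_div₀, h1, hδ, map_mul, AlgEquiv.commutes, mul_div_mul_left]
    simp
  rw [div_eq_iff (coord_ne_zero j)] at hz
  refine ⟨z, ?_, hz⟩
  rintro rfl
  rw [map_zero, zero_mul, EmbeddingLike.map_eq_zero_iff] at hz
  exact coord_ne_zero j hz

/-- An element of `G` that commutes with the kernel lies in the kernel. -/
lemma mem_ker_expHom_of_commute {f : admissibleGroup n}
    (h : ∀ k ∈ (expHom n).ker, Commute f k) : f ∈ (expHom n).ker := by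
  have hcomm : ∀ c : Fin n → ℂˣ, Commute (f : Cremona n) (diagonalMap c) := fun c => by
    have hk : (⟨diagonalMap c, diagonalMap_mem c⟩ : admissibleGroup n) ∈ (expHom n).ker := by
      refine mem_ker_expHom (c := fun j => c j) (fun j => (c j).ne_zero) fun j => ?_
      rw [diagonalMap_coord, ← laurent_single j]
      congr 2
      funext i
      simp [Matrix.one_apply, Pi.single_apply, eq_comm]
    exact (h _ hk).map (admissibleGroup n).subtype
  choose z hz hf using exists_smul_coord_of_commute hcomm
  exact mem_ker_expHom hz hf

end Torus

/-! ### The monomial section of `ρ`. -/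

section Splitting

variable {n : ℕ}

lemma monomialHom_spec {A : GL (Fin n) ℤ} (hA : A ∈ fixGL n) :
    ∃ F, Represents F (monomialHom n A) ∧ HasShape F ∧
      expMatrix F = (A : Matrix (Fin n) (Fin n) ℤ).transpose :=
  exists_represents_of_monomial (c := fun _ => 1) (fun _ => one_ne_zero) hA fun j => by
    rw [monomialHom_coord, map_one, one_mul]

lemma monomialHom_mem {A : GL (Fin n) ℤ} (hA : A ∈ fixGL n) :
    monomialHom n A ∈ admissibleGroup n := by
  obtain ⟨F, hF, hs, -⟩ := monomialHom_spec hA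
  obtain ⟨H, hH, hHs, -⟩ := monomialHom_spec (inv_mem hA)
  exact ⟨⟨F, hF, hs⟩, ⟨H, by rwa [← map_inv], hHs⟩⟩

/-- The section `s` of `ρ` over `GL'_n(ℤ)`. -/
noncomputable def monomialSection (n : ℕ) : fixGL n →* admissibleGroup n :=
  ((monomialHom n).comp (fixGL n).subtype).codRestrict _ fun A => monomialHom_mem A.2

lemma expHom_monomialSection (A : fixGL n) : expHom n (monomialSection n A) = A := by
  obtain ⟨F, hF, -, hM⟩ := monomialHom_spec A.2
  apply Units.ext
  rw [expHom_eq _ hF, hM, Matrix.transpose_transpose]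

end Splitting

/-! ### Group theory of split extensions. -/

section SplitExtension

variable {G Q : Type*} [Group G] [Group Q]

/-- A homomorphism that splits over its image gives complementary subgroups. -/
lemma MonoidHom.isComplement'_ker_range_of_split {ρ : G →* Q} {K : Subgroup Q} (hK : ρ.range = K)
    {s : K →* G} (hs : ∀ a : K, ρ (s a) = a) : ρ.ker.IsComplement' s.range := by
  refine Subgroup.isComplement'_of_disjoint_and_mul_eq_univ ?_ ?_
  · rw [Subgroup.disjoint_def]
    rintro _ hx ⟨a, rfl⟩
    rw [MonoidHom.mem_ker, hs] at hx
    rw [show a = 1 from Subtype.ext hx, map_one]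
  · refine Set.eq_univ_of_forall fun g => ?_
    let a : K := ⟨ρ g, hK ▸ ⟨g, rfl⟩⟩
    refine Set.mem_mul.mpr ⟨g * (s a)⁻¹, ?_, s a, ⟨a, rfl⟩, by simp⟩
    simp [MonoidHom.mem_ker, hs, a]

lemma MonoidHom.ker_inf_map_of_split {ρ : G →* Q} {K : Subgroup Q} {s : K →* G}
    (hs : ∀ a : K, ρ (s a) = a) (L : Subgroup K) : ρ.ker ⊓ L.map s = ⊥ := by
  rw [eq_bot_iff]
  rintro _ ⟨hx, a, -, rfl⟩
  have hx' : ρ (s a) = 1 := hx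
  rw [hs] at hx'
  rw [Subgroup.mem_bot, show a = 1 from Subtype.ext hx', map_one]

/-- Each `g` over `L` factors as `(g * (s (ρ g))⁻¹) * s (ρ g)`. With `L = SL'_n(ℤ)` and the trivial
intersection above, this gives the second semidirect product. -/
lemma MonoidHom.ker_sup_map_of_split {ρ : G →* Q} {K : Subgroup Q} {s : K →* G}
    (hs : ∀ a : K, ρ (s a) = a) {L : Subgroup Q} (hL : L ≤ K) :
    ρ.ker ⊔ (L.subgroupOf K).map s = L.comap ρ := by
  apply le_antisymm
  · refine sup_le (fun x hx => ?_) ?_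
    · rw [Subgroup.mem_comap, (MonoidHom.mem_ker).mp hx]
      exact one_mem _
    · rintro _ ⟨a, ha, rfl⟩
      rw [Subgroup.mem_comap, hs]
      exact ha
  · intro g hg
    let a : K := ⟨ρ g, hL hg⟩
    rw [← inv_mul_cancel_right g (s a)]
    refine mul_mem (Subgroup.mem_sup_left ?_) (Subgroup.mem_sup_right ⟨a, hg, rfl⟩)
    simp [MonoidHom.mem_ker, hs, a]

/-- The action on the kernel of a group homomorphism embeds a splitting subgroup into the outer
automorphism group of the kernel, as soon as the centralizer of the kernel lies in the kernel. -/
lemma MonoidHom.exists_outer_injective_of_split {ρ : G →* Q} {K : Subgroup Q} {s : K →* G}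
    (hs : ∀ a : K, ρ (s a) = a) (hc : ∀ f : G, (∀ k ∈ ρ.ker, Commute f k) → f ∈ ρ.ker) :
    ∃ φ : K →* OuterAut ρ.ker, Function.Injective φ := by
  refine ⟨((QuotientGroup.mk' (MulAut.conj (G := ρ.ker)).range).comp
    (MulAut.conjNormal (H := ρ.ker))).comp s, ?_⟩
  rw [injective_iff_map_eq_one]
  intro a ha
  -- If `s a` acts on the kernel as conjugation by some `l` in the kernel, then `l⁻¹ * s a`
  -- centralizes the kernel and so lies in it. Hence `s a` lies in the kernel, and `a = ρ (s a) =
  -- 1`.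
  obtain ⟨l, hl⟩ := (QuotientGroup.eq_one_iff _).mp ha
  have hmem : (l : G)⁻¹ * s a ∈ ρ.ker := hc _ fun k hk => by
    have h1 : (l : G) * k * (l : G)⁻¹ = s a * k * (s a)⁻¹ :=
      congrArg Subtype.val (DFunLike.congr_fun hl (⟨k, hk⟩ : ρ.ker))
    have h2 : s a * k = l * k * (l : G)⁻¹ * s a := by rw [h1]; group
    rw [Commute, SemiconjBy, mul_assoc, h2]
    group
  have h3 : s a ∈ ρ.ker := by
    have := mul_mem l.2 hmem
    rwa [mul_inv_cancel_left] at this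
  rw [MonoidHom.mem_ker, hs] at h3
  exact Subtype.ext h3

end SplitExtension

/-! ### The main theorem. -/

theorem corollary2p4 (n : ℕ) (hn : 3 ≤ n) :
    ∃ ρ : admissibleGroup n →* GL (Fin n) ℤ,
      (∀ (f : admissibleGroup n) (F : Fin (n + 1) → MvPolynomial (Fin (n + 1)) ℂ),
        Represents F (f : Cremona n) →
          ((ρ f : GL (Fin n) ℤ) : Matrix (Fin n) (Fin n) ℤ) = (expMatrix F).transpose) ∧
      ρ.range = fixGL n ∧
      (∃ s : fixGL n →* admissibleGroup n,
        (∀ (A : fixGL n) (j : Fin n),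
          ((s A : Cremona n)).unop (coord j) =
            ∏ i, coord i ^ ((A : GL (Fin n) ℤ) : Matrix (Fin n) (Fin n) ℤ) j i) ∧
        (∀ A : fixGL n, ρ (s A) = A) ∧
        ρ.ker.IsComplement' s.range ∧
        ρ.ker ⊓ ((fixSL n).subgroupOf (fixGL n)).map s = ⊥ ∧
        ρ.ker ⊔ ((fixSL n).subgroupOf (fixGL n)).map s = (fixSL n).comap ρ) ∧
      ∃ φ : FreeGroup (Fin 2) →* OuterAut ρ.ker, Function.Injective φ := by
  have hs := expHom_monomialSection (n := n)
  have hrange : (expHom n).range = fixGL n := by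
    apply le_antisymm
    · rintro _ ⟨f, rfl⟩
      exact expHom_mem_fixGL f
    · exact fun A hA => ⟨monomialSection n ⟨A, hA⟩, hs ⟨A, hA⟩⟩
  obtain ⟨φ, hφ⟩ := exists_freeGroup_injective_fixGL hn
  obtain ⟨ψ, hψ⟩ :=
    MonoidHom.exists_outer_injective_of_split hs fun f => mem_ker_expHom_of_commute
  exact ⟨expHom n, fun f F hF => expHom_eq f hF, hrange,
    ⟨monomialSection n, fun A j => monomialHom_coord _ j, hs,
      MonoidHom.isComplement'_ker_range_of_split hrange hs, MonoidHom.ker_inf_map_of_split hs _,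
      MonoidHom.ker_sup_map_of_split hs inf_le_left⟩,
    ψ.comp φ, hψ.comp hφ⟩
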